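/- Let $d(x,\mathbb Z)$ denote the distance from the real number $x$ to the nearest integer. Call a real number $a$ badly approximable in the weak sense if for every $\epsilon>0$ there is a constant $c>0$ with $d(ka,\mathbb Z)\ge c\,k^{-1-\epsilon}$ for all integers $k>0$, and badly approximable in the strong sense if there is $c>0$ with $d(ka,\mathbb Z)\ge c\,k^{-1}$ for all integers $k>0$. Call a sequence $(B_k)_{k\ge 1}$ of events in a probability space strongly Borel–Cantelli if $\sum_{k\ge1}\mathbb P(B_k)=\infty$ and, with $S_n=\sum_{k=1}^n \mathbf 1_{B_k}$ and $E_n=\mathbb E(S_n)$, $\lim_{n\to\infty}S_n/E_n=1$ almost surely. Let $a\in[0,1]$ be irrational and badly approximable in the weak sense, and let $(X_n)_{n\ge0}$ be the stationary symmetric random walk on the circle $\mathbb R/\mathbb Z$ with step $a$, that is, the stationary Markov chain with transition kernel $$Kf(x)=\tfrac12\bigl(f(x+a)+f(x-a)\bigr)$$ whose invariant distribution is the normalized Lebesgue–Haar measure. For real $t\in[0,1)$ and real $\delta$, put $Y_n=X_n-nt$ (in $\mathbb R/\mathbb Z$) and $B_n=\{Y_n\in I_n\}$ for $n\ge1$,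 where $I_n$ is the image of $[0,n^{-\delta}]$ in $\mathbb R/\mathbb Z$. 1. If $\delta<1/3$, then $(B_n)_{n\ge1}$ is a strongly Borel–Cantelli sequence for every $t\in[0,1)$. 2. If $t\in[0,1)$ is badly approximable in the strong sense, then $(B_n)_{n\ge1}$ is a strongly Borel–Cantelli sequence for every $\delta<1/2$. -/

import Mathlib

open MeasureTheory ProbabilityTheory Filter Topology
open scoped ENNReal

/-- `d(k a, ℤ) ≥ c k^{-1-ε}` for all integers `k > 0`, for some constant `c > 0`. -/
def BadlyApproximableWith (a ε : ℝ) : Prop :=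
  ∃ c : ℝ, 0 < c ∧ ∀ k : ℕ, 0 < k →
    c * (k : ℝ) ^ (-1 - ε) ≤ Metric.infDist ((k : ℝ) * a) (Set.range ((↑) : ℤ → ℝ))

/-- Badly approximable in the weak sense. -/
def WeaklyBadlyApproximable (a : ℝ) : Prop :=
  ∀ ε : ℝ, 0 < ε → BadlyApproximableWith a ε

/-- Badly approximable in the strong sense. -/
def StronglyBadlyApproximable (a : ℝ) : Prop :=
  BadlyApproximableWith a 0

/-- The kernel of the symmetric random walk on the circle `ℝ/ℤ` with step `a`: from `x`, jump to
`x + a` or `x - a`, with probability `1/2` each. -/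
noncomputable def circleWalkKernel (a : ℝ) : Kernel UnitAddCircle UnitAddCircle where
  toFun x := (2⁻¹ : ℝ≥0∞) •
    (Measure.dirac (x + (a : UnitAddCircle)) + Measure.dirac (x - (a : UnitAddCircle)))
  measurable' := by
    refine Measure.measurable_of_measurable_coe _ fun s hs => ?_
    have hadd : Measurable fun x : UnitAddCircle =>
        Measure.dirac (x + (a : UnitAddCircle)) s :=
      (Measure.measurable_coe hs).comp (Measure.measurable_dirac.comp (measurable_id.add_const _))
    have hsub : Measurable fun x : UnitAddCircle =>
        Measure.dirac (x - (a : UnitAddCircle)) s :=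
      (Measure.measurable_coe hs).comp (Measure.measurable_dirac.comp (measurable_id.sub_const _))
    exact (hadd.add hsub).const_mul _

/-- `(X n)` is, under `P`, a stationary Markov chain with transition kernel `K` and marginal
distribution `π`: conditionally on the past `σ(X i, i ≤ n)`, the variable `X (n + 1)` has
distribution `K (X n)`. -/
structure IsStationaryMarkovChain {Ω E : Type*} [MeasurableSpace Ω] [MeasurableSpace E]
    (P : Measure Ω) (K : Kernel E E) (π : Measure E) (X : ℕ → Ω → E) : Prop where
  measurable : ∀ n, Measurable (X n)
  law : ∀ n, P.map (X n) = π
  markov : ∀ n, ∀ A : Set E, MeasurableSet A →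
    P[(X (n + 1) ⁻¹' A).indicator (fun _ => (1 : ℝ)) |
        ⨆ i ∈ Set.Iic n, MeasurableSpace.comap (X i) inferInstance]
      =ᵐ[P] fun ω => (K (X n ω)).real A

/-- `S_n`, the number of events that occur among `B 1, …, B n`. -/
noncomputable def eventCount {Ω : Type*} (B : ℕ → Set Ω) (n : ℕ) (ω : Ω) : ℝ :=
  ∑ k ∈ Finset.Icc 1 n, (B k).indicator (fun _ => (1 : ℝ)) ω

/-- The sequence `(B k)_{k ≥ 1}` is strongly Borel-Cantelli: it consists of events,
`∑ P(B k) = ∞`, and `S_n / E[S_n] → 1` almost surely. -/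
structure IsStronglyBorelCantelli {Ω : Type*} [MeasurableSpace Ω] (P : Measure Ω)
    (B : ℕ → Set Ω) : Prop where
  measurableSet : ∀ k, 1 ≤ k → MeasurableSet (B k)
  tsum_eq_top : ∑' k : ℕ, P (B (k + 1)) = ∞
  tendsto_ratio : ∀ᵐ ω ∂P,
    Tendsto (fun n : ℕ => eventCount B n ω / ∫ ω', eventCount B n ω' ∂P) atTop (𝓝 1)

/-- The event that `X n - n t` lies in the image on the circle of the interval `[0, n ^ (-δ)]`. -/
def driftEvent {Ω : Type*} (X : ℕ → Ω → UnitAddCircle) (t δ : ℝ) (n : ℕ) : Set Ω :=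
  {ω | X n ω - (((n : ℝ) * t : ℝ) : UnitAddCircle) ∈
    (fun x : ℝ => (x : UnitAddCircle)) '' Set.Icc (0 : ℝ) ((n : ℝ) ^ (-δ))}

/-!
The argument is a second moment computation in Fourier space, uniform in the drift `t`.

The walk multiplies the Fourier mode `k` by `cos (2 π k a)` at each step, and the `k`-th Fourier
coefficient of the indicator of an arc is at most `1 / |k|` in modulus, wherever the arc is; the
drift only moves the arcs. By Parseval's identity the covariance of the indicators of `B i` and
`B (i + m)` is therefore at most `r m = ∑ |cos (2 π k a)| ^ m / k ^ 2`, summed over `k ≠ 0`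
(`IsStationaryMarkovChain.abs_measureReal_inter_sub_le`).

The sums of `r m` over `m < n` are `O(n ^ θ)` for every `θ > 0` (`exists_sum_correlationBound_le`).
The modes `k > n` contribute at most `n / k ^ 2` each. For `k ≤ n` the geometric series is
at most a constant times `‖2 k a‖ ^ (-2)`, where `‖x‖` is the distance to the nearest integer, so
that `∑ k ^ (-2) ‖2 k a‖ ^ (-2)` has to be controlled. The individual terms are too large for
this, but as `a` is badly approximable the numbers `‖2 k a‖` with `k ≤ n` are separated by a
constant times `n ^ (-1 - ε)`, so that `∑ ‖2 k a‖ ^ (-2)` over `k ≤ n` is `O(n ^ (2 + 2 ε))`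
(`sum_one_div_norm_nsmul_sq_le`); summation by parts does the rest.

Hence `S n` has variance `O(n ^ (1 + θ))`, whereas `E n` is at least `n ^ (1 - δ)`. For `δ < 1 / 2`
and a small `θ` the variance of `S n / E n` is at most a negative power of `n`. It is summable along
`n = j ^ K` for a large `K`, which gives the convergence along this subsequence, and the
monotonicity of `S n` and `E n` gives it along all integers
(`isStronglyBorelCantelli_of_covariance_le`).
-/

/-! ### Small denominators -/

theorem UnitAddCircle.norm_coe_le_abs (x : ℝ) : ‖(x : UnitAddCircle)‖ ≤ |x| := by
  rw [UnitAddCircle.norm_eq]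
  simpa using round_le x 0

theorem UnitAddCircle.exists_coe_eq_abs_eq_norm (x : UnitAddCircle) :
    ∃ r : ℝ, (r : UnitAddCircle) = x ∧ |r| = ‖x‖ := by
  induction x using QuotientAddGroup.induction_on with
  | H z =>
    refine ⟨z - round z, ?_, (UnitAddCircle.norm_eq (x := z)).symm⟩
    rw [AddCircle.coe_sub, sub_eq_self]
    exact (AddCircle.coe_eq_zero_iff 1).2 ⟨round z, by simp⟩

/-- The distances to `0` of two points of the circle can only be close to each other if the points
are close to each other, or are almost opposite. -/
theorem UnitAddCircle.min_norm_sub_norm_add_le (x y : UnitAddCircle) :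
    min ‖x - y‖ ‖x + y‖ ≤ |‖x‖ - ‖y‖| := by
  obtain ⟨r, rfl, hr⟩ := UnitAddCircle.exists_coe_eq_abs_eq_norm x
  obtain ⟨s, rfl, hs⟩ := UnitAddCircle.exists_coe_eq_abs_eq_norm y
  rw [← hr, ← hs, ← AddCircle.coe_sub, ← AddCircle.coe_add]
  have h1 := UnitAddCircle.norm_coe_le_abs (r - s)
  have h2 := UnitAddCircle.norm_coe_le_abs (r + s)
  rcases abs_cases r with ⟨h3, h4⟩ | ⟨h3, h4⟩ <;> rcases abs_cases s with ⟨h5, h6⟩ | ⟨h5, h6⟩ <;>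
    rw [h3, h5]
  · exact min_le_of_left_le h1
  · exact min_le_of_right_le (by simpa using h2)
  · refine min_le_of_right_le (h2.trans ?_)
    rw [show -r - s = -(r + s) by ring, abs_neg]
  · refine min_le_of_left_le (h1.trans ?_)
    rw [show -r - -s = -(r - s) by ring, abs_neg]

/-- If the values of `f` are at least `d` and `d`-separated, then they are at least as spread out
as `d, 2d, 3d, …`. -/
theorem sum_one_div_sq_le_of_separated {ι : Type*} (s : Finset ι) (f : ι → ℝ) {d : ℝ} (hd : 0 < d)
    (hf : ∀ k ∈ s, d ≤ f k) (hsep : ∀ k ∈ s, ∀ l ∈ s, k ≠ l → d ≤ |f k - f l|) :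
    ∑ k ∈ s, 1 / f k ^ 2 ≤ (∑' j : ℕ, 1 / (j : ℝ) ^ 2) / d ^ 2 := by
  classical
  -- Distinct indices have distinct values of `⌊f k / d⌋₊`, which are positive integers.
  have hfloor : ∀ k ∈ s, (⌊f k / d⌋₊ : ℝ) ≤ f k / d ∧ f k / d < ⌊f k / d⌋₊ + 1 := fun k hk =>
    ⟨Nat.floor_le (div_nonneg (hd.le.trans (hf k hk)) hd.le), Nat.lt_floor_add_one _⟩
  have hinj : Set.InjOn (fun k => ⌊f k / d⌋₊) (s : Set ι) := by
    intro k hk l hl hkl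
    by_contra hne
    have h1 := hfloor k hk
    have h2 := hfloor l hl
    simp only at hkl
    rw [hkl] at h1
    have h3 := hsep k hk l hl hne
    have h4 : |f k / d - f l / d| < 1 := abs_lt.2 ⟨by linarith, by linarith⟩
    rw [← sub_div, abs_div, abs_of_pos hd, div_lt_one hd] at h4
    linarith
  have hterm : ∀ k ∈ s, 1 / f k ^ 2 ≤ 1 / (⌊f k / d⌋₊ : ℝ) ^ 2 / d ^ 2 := by
    intro k hk
    have h1 : 1 ≤ ⌊f k / d⌋₊ := Nat.le_floor (by simpa using (one_le_div hd).2 (hf k hk))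
    have h2 : (0 : ℝ) < ⌊f k / d⌋₊ := by exact_mod_cast h1
    rw [div_div, ← mul_pow]
    refine one_div_le_one_div_of_le (by positivity) (pow_le_pow_left₀ (by positivity) ?_ 2)
    exact (le_div_iff₀ hd).1 (hfloor k hk).1
  calc ∑ k ∈ s, 1 / f k ^ 2 ≤ ∑ k ∈ s, 1 / (⌊f k / d⌋₊ : ℝ) ^ 2 / d ^ 2 := Finset.sum_le_sum hterm
    _ = (∑ j ∈ s.image fun k => ⌊f k / d⌋₊, 1 / (j : ℝ) ^ 2) / d ^ 2 := by
        rw [Finset.sum_image hinj, Finset.sum_div]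
    _ ≤ _ := by
        gcongr
        exact (Real.summable_one_div_nat_pow.2 one_lt_two).sum_le_tsum _ fun _ _ => by positivity

/-- The multiples of a badly approximable number are so well separated that the sum of
`1 / ‖k α‖ ^ 2` over `k ≤ n` is of the order of its largest possible term. -/
theorem sum_one_div_norm_nsmul_sq_le {α : UnitAddCircle} {c ε : ℝ} (hc : 0 < c) (hε : 0 ≤ ε)
    (h : ∀ k : ℕ, 0 < k → c * (k : ℝ) ^ (-1 - ε) ≤ ‖k • α‖) (n : ℕ) :
    ∑ k ∈ Finset.Icc 1 n, 1 / ‖k • α‖ ^ 2 ≤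
      (∑' j : ℕ, 1 / (j : ℝ) ^ 2) / (c * 2 ^ (-1 - ε)) ^ 2 * (n : ℝ) ^ (2 + 2 * ε) := by
  rcases Nat.eq_zero_or_pos n with rfl | hn
  · simp; positivity
  have hn' : (0 : ℝ) < n := by exact_mod_cast hn
  -- The bound is needed up to `2 * n` because it is applied to `k + l` as well as to `k - l`.
  have hle : ∀ k : ℕ, 0 < k → k ≤ 2 * n → c * (2 * n : ℝ) ^ (-1 - ε) ≤ ‖k • α‖ := by
    intro k hk hkn
    refine le_trans ?_ (h k hk)
    refine mul_le_mul_of_nonneg_left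
      (Real.rpow_le_rpow_of_nonpos (by exact_mod_cast hk) ?_ ?_) hc.le
    · exact_mod_cast hkn
    · linarith
  have key := sum_one_div_sq_le_of_separated (Finset.Icc 1 n) (fun k => ‖k • α‖)
    (d := c * (2 * n : ℝ) ^ (-1 - ε)) (by positivity) ?_ ?_
  · refine key.trans_eq ?_
    rw [Real.mul_rpow (by positivity) (by positivity), ← mul_assoc, mul_pow, ← Real.rpow_natCast
      ((n : ℝ) ^ (-1 - ε)), ← Real.rpow_mul hn'.le, ← div_div, div_eq_mul_inv _ ((n : ℝ) ^ _),
      ← Real.rpow_neg hn'.le]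
    congr 2
    push_cast; ring
  · intro k hk
    rw [Finset.mem_Icc] at hk
    exact hle k (by omega) (by omega)
  · have aux : ∀ k l : ℕ, k ∈ Finset.Icc 1 n → l ∈ Finset.Icc 1 n → l < k →
        c * (2 * n : ℝ) ^ (-1 - ε) ≤ |‖k • α‖ - ‖l • α‖| := by
      intro k l hk hl hlk
      rw [Finset.mem_Icc] at hk hl
      refine le_trans (le_min ?_ ?_) (UnitAddCircle.min_norm_sub_norm_add_le _ _)
      · rw [← eq_sub_of_add_eq (sub_nsmul_nsmul_add α hlk.le)]
        exact hle _ (by omega) (by omega)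
      · rw [← add_nsmul]
        exact hle _ (by omega) (by omega)
    intro k hk l hl hkl
    rcases lt_or_gt_of_ne hkl with h1 | h1
    · rw [abs_sub_comm]; exact aux l k hl hk h1
    · exact aux k l hk hl h1

theorem summable_one_div_norm_nsmul_sq_mul_rpow {α : UnitAddCircle} {c ε s : ℝ} (hc : 0 < c)
    (hε : 0 ≤ ε) (h : ∀ k : ℕ, 0 < k → c * (k : ℝ) ^ (-1 - ε) ≤ ‖k • α‖) (hs : 2 + 2 * ε < s) :
    Summable fun k : ℕ => 1 / ‖k • α‖ ^ 2 * (k : ℝ) ^ (-s) := by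
  have hS : LSeriesSummable (fun k : ℕ => ((1 / ‖k • α‖ ^ 2 : ℝ) : ℂ)) (s : ℂ) := by
    refine LSeriesSummable_of_sum_norm_bigO_and_nonneg (r := 2 + 2 * ε) ?_
      (fun _ => by positivity) (by positivity) (by simpa using hs)
    refine Asymptotics.IsBigO.of_bound ((∑' j : ℕ, 1 / (j : ℝ) ^ 2) / (c * 2 ^ (-1 - ε)) ^ 2)
      (Eventually.of_forall fun n => ?_)
    rw [Real.norm_of_nonneg (Finset.sum_nonneg fun _ _ => by positivity),
      Real.norm_of_nonneg (by positivity)]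
    exact sum_one_div_norm_nsmul_sq_le hc hε h n
  refine hS.norm.congr fun k => ?_
  rcases Nat.eq_zero_or_pos k with rfl | hk
  · simp
  · have hk' : (0 : ℝ) < k := by exact_mod_cast hk
    rw [LSeries.term_of_ne_zero hk.ne', norm_div, Complex.norm_real,
      Complex.norm_natCast_cpow_of_pos hk, Real.norm_of_nonneg (by positivity), Real.rpow_neg hk'.le, Complex.ofReal_re, div_eq_mul_inv]

theorem abs_cos_pi_mul_le (x : ℝ) :
    |Real.cos (Real.pi * x)| ≤ 1 - 2 * ‖(x : UnitAddCircle)‖ ^ 2 := by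
  rw [UnitAddCircle.norm_eq]
  set r := x - round x with hr
  have h1 : |r| ≤ 1 / 2 := abs_sub_round x
  have h2 : |Real.cos (Real.pi * x)| = |Real.cos (Real.pi * r)| := by
    rw [hr, mul_sub, mul_comm Real.pi (round x : ℝ), Real.cos_sub_int_mul_pi]
    simp [abs_mul, abs_zpow]
  have h3 : |Real.pi * r| ≤ Real.pi / 2 := by
    rw [abs_mul, abs_of_pos Real.pi_pos]
    nlinarith [Real.pi_pos]
  have h4 := Real.cos_le_one_sub_mul_cos_sq (h3.trans (by linarith [Real.pi_pos]))
  rw [h2, abs_of_nonneg (Real.cos_nonneg_of_mem_Icc (by rwa [Set.mem_Icc, ← abs_le]))]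
  refine h4.trans_eq ?_
  rw [sq_abs]
  field_simp [Real.pi_pos.ne']

/-- A bound for the covariance of the indicators of two arcs under the stationary walk, at times
that differ by `m`: each Fourier mode `k` of an indicator is at most `1 / |k|`, and is multiplied by
`cos (2 π k a)` at each step. The mode `k = 0` does not contribute, as `1 / 0 = 0`. -/
noncomputable def correlationBound (a : ℝ) (m : ℕ) : ℝ :=
  ∑' k : ℤ, 1 / (k : ℝ) ^ 2 * |Real.cos (2 * Real.pi * (k * a))| ^ m

theorem summable_correlationBound (a : ℝ) (m : ℕ) :
    Summable fun k : ℤ => 1 / (k : ℝ) ^ 2 * |Real.cos (2 * Real.pi * (k * a))| ^ m := by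
  refine Summable.of_nonneg_of_le (fun k => by positivity) (fun k => ?_)
    (Real.summable_one_div_int_pow.2 one_lt_two)
  exact mul_le_of_le_one_right (by positivity)
    (pow_le_one₀ (abs_nonneg _) (Real.abs_cos_le_one _))

theorem correlationBound_nonneg (a : ℝ) (m : ℕ) : 0 ≤ correlationBound a m :=
  tsum_nonneg fun _ => by positivity

/-- Interpolation between the bound `n / k ^ 2`, which is good for `k > n`, and the bound by the
full geometric series, which is good for `k ≤ n`. -/
theorem sum_pow_div_sq_le {k n : ℕ} (hk : 0 < k) {ρ w θ : ℝ} (hθ : 0 ≤ θ) (hθ1 : θ ≤ 1) (hρ : 0 ≤ ρ)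
    (hw : 0 < w) (hρw : ρ ≤ 1 - w) :
    1 / (k : ℝ) ^ 2 * ∑ m ∈ Finset.range n, ρ ^ m ≤
      (n : ℝ) ^ θ * ((k : ℝ) ^ (-1 - θ) + 1 / w * (k : ℝ) ^ (-2 - θ)) := by
  have hk' : (0 : ℝ) < k := by exact_mod_cast hk
  have e2 : 1 / (k : ℝ) ^ 2 = (k : ℝ) ^ θ * (k : ℝ) ^ (-2 - θ) := by
    rw [← Real.rpow_add hk', show θ + (-2 - θ) = -((2 : ℕ) : ℝ) by push_cast; ring,
      Real.rpow_neg hk'.le, Real.rpow_natCast, one_div]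
  rcases le_or_gt k n with hkn | hkn
  · have hgeom : ∑ m ∈ Finset.range n, ρ ^ m ≤ 1 / w := by
      rw [geom_sum_eq (by linarith), ← neg_div_neg_eq]
      gcongr
      · linarith [pow_nonneg hρ n]
      · linarith
    calc 1 / (k : ℝ) ^ 2 * ∑ m ∈ Finset.range n, ρ ^ m ≤ 1 / (k : ℝ) ^ 2 * (1 / w) := by gcongr
      _ = (k : ℝ) ^ θ * (1 / w * (k : ℝ) ^ (-2 - θ)) := by rw [e2]; ring
      _ ≤ (n : ℝ) ^ θ * (1 / w * (k : ℝ) ^ (-2 - θ)) := by gcongr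
      _ ≤ _ := by gcongr; exact le_add_of_nonneg_left (by positivity)
  · rcases Nat.eq_zero_or_pos n with rfl | hn
    · simp; positivity
    have hn' : (0 : ℝ) < n := by exact_mod_cast hn
    have hsum : ∑ m ∈ Finset.range n, ρ ^ m ≤ n := by
      refine (Finset.sum_le_card_nsmul _ _ 1 fun m _ => pow_le_one₀ hρ (by linarith)).trans ?_
      simp
    calc 1 / (k : ℝ) ^ 2 * ∑ m ∈ Finset.range n, ρ ^ m
        ≤ 1 / (k : ℝ) ^ 2 * ((n : ℝ) ^ θ * (n : ℝ) ^ (1 - θ)) := by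
          rw [← Real.rpow_add hn', add_sub_cancel, Real.rpow_one]
          gcongr
      _ ≤ 1 / (k : ℝ) ^ 2 * ((n : ℝ) ^ θ * (k : ℝ) ^ (1 - θ)) := by
          gcongr
      _ = (n : ℝ) ^ θ * (k : ℝ) ^ (-1 - θ) := by
          rw [e2, mul_left_comm, ← Real.rpow_add hk', ← Real.rpow_add hk']
          congr 2
          ring
      _ ≤ _ := by gcongr; exact le_add_of_nonneg_right (by positivity)

theorem WeaklyBadlyApproximable.exists_le_norm_nsmul {a : ℝ} (ha : WeaklyBadlyApproximable a)
    {ε : ℝ} (hε : 0 < ε) :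
    ∃ c : ℝ, 0 < c ∧
      ∀ k : ℕ, 0 < k → c * (k : ℝ) ^ (-1 - ε) ≤ ‖k • ((2 * a : ℝ) : UnitAddCircle)‖ := by
  obtain ⟨c, hc, h⟩ := ha ε hε
  refine ⟨c * 2 ^ (-1 - ε), by positivity, fun k hk => ?_⟩
  have h1 := h (2 * k) (by omega)
  rw [← AddCircle.coe_nsmul, UnitAddCircle.norm_eq, nsmul_eq_mul]
  have h2 := Metric.infDist_le_dist_of_mem (x := ((2 * k : ℕ) : ℝ) * a)
    (Set.mem_range_self (f := ((↑) : ℤ → ℝ)) (round ((k : ℝ) * (2 * a))))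
  rw [Real.dist_eq] at h2
  push_cast at h1 h2
  rw [Real.mul_rpow (by norm_num) (by positivity), ← mul_assoc] at h1
  rw [show (k : ℝ) * (2 * a) = 2 * k * a by ring] at h2 ⊢
  exact h1.trans h2

/-- The covariances have sums of order `n ^ θ`, for all `θ > 0`. -/
theorem exists_sum_correlationBound_le {a : ℝ} (ha : WeaklyBadlyApproximable a) {θ : ℝ}
    (hθ : 0 < θ) (hθ1 : θ ≤ 1) :
    ∃ C : ℝ, ∀ n : ℕ, ∑ m ∈ Finset.range n, correlationBound a m ≤ C * (n : ℝ) ^ θ := by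
  -- With `ε = θ / 4`, the sums of `1 / ‖k • β‖ ^ 2` have exponent `2 + θ / 2 < 2 + θ`.
  obtain ⟨c, hc, h⟩ := ha.exists_le_norm_nsmul (ε := θ / 4) (by positivity)
  set β := ((2 * a : ℝ) : UnitAddCircle) with hβ
  set G : ℕ → ℝ := fun k => (k : ℝ) ^ (-1 - θ) + 1 / (2 * ‖k • β‖ ^ 2) * (k : ℝ) ^ (-2 - θ) with hG
  have hG0 : ∀ k, 0 ≤ G k := fun k => by positivity
  have hGs : Summable G := by
    refine Summable.add (Real.summable_nat_rpow.2 (by linarith)) ?_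
    refine ((summable_one_div_norm_nsmul_sq_mul_rpow (s := 2 + θ) hc (by positivity) h
      (by linarith)).mul_left (1 / 2)).congr fun k => ?_
    rw [show -(2 + θ) = -2 - θ by ring, ← mul_assoc, div_mul_div_comm, one_mul]
  have hGs' : Summable fun k : ℤ => G k.natAbs := by
    refine summable_int_iff_summable_nat_and_neg.2 ⟨?_, ?_⟩ <;> simpa using hGs
  refine ⟨∑' k : ℤ, G k.natAbs, fun n => ?_⟩
  simp_rw [correlationBound]
  rw [← Summable.tsum_finsetSum fun m _ => summable_correlationBound a m, mul_comm _ ((n : ℝ) ^ θ),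
    ← tsum_mul_left]
  refine Summable.tsum_le_tsum (fun k => ?_) (summable_sum fun m _ => summable_correlationBound a m)
    (hGs'.mul_left _)
  rw [← Finset.mul_sum]
  rcases eq_or_ne k 0 with rfl | hk
  · simp only [Int.cast_zero, ne_eq, OfNat.ofNat_ne_zero, not_false_eq_true, zero_pow, div_zero,
      zero_mul]
    exact mul_nonneg (by positivity) (hG0 _)
  · have hk' : 0 < k.natAbs := Int.natAbs_pos.2 hk
    have e1 : (k : ℝ) ^ 2 = (k.natAbs : ℝ) ^ 2 := by rw [Nat.cast_natAbs, Int.cast_abs, sq_abs]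
    have e2 : |Real.cos (2 * Real.pi * (k * a))| =
        |Real.cos (Real.pi * (k.natAbs * (2 * a)))| := by
      rw [Nat.cast_natAbs, Int.cast_abs]
      rcases abs_cases (k : ℝ) with ⟨h1, -⟩ | ⟨h1, -⟩ <;> rw [h1]
      · congr 2; ring
      · rw [← Real.cos_neg]
        congr 2; ring
    have h3 := abs_cos_pi_mul_le (k.natAbs * (2 * a))
    rw [← nsmul_eq_mul, AddCircle.coe_nsmul, nsmul_eq_mul] at h3
    have h4 : 0 < ‖k.natAbs • β‖ := lt_of_lt_of_le (by positivity) (h _ hk')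
    rw [e1, e2]
    exact sum_pow_div_sq_le hk' hθ.le hθ1 (abs_nonneg _) (by positivity) h3

/-! ### The transition operator in Fourier space -/

open AddCircle in
theorem fourierCoeff_comp_add_right (g : UnitAddCircle → ℂ) (c : UnitAddCircle) (k : ℤ) :
    fourierCoeff (fun x => g (x + c)) k = fourier k c * fourierCoeff g k := by
  unfold fourierCoeff
  rw [← integral_const_mul, ← integral_add_right_eq_self _ (-c)]
  refine integral_congr_ae (Eventually.of_forall fun x => ?_)
  have h : fourier k c = fourier (-k) (-c) := by
    rw [fourier_apply, fourier_apply, neg_smul_neg]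
  simp only [neg_add_cancel_right, smul_eq_mul]
  rw [← mul_assoc, h, fourier_apply, fourier_apply, fourier_apply, smul_add, AddCircle.toCircle_add,
    Circle.coe_mul]
  ring

/-- The transition operator `g ↦ K g` of the walk. -/
noncomputable def walkOperator (a : ℝ) (g : UnitAddCircle → ℂ) (x : UnitAddCircle) : ℂ :=
  2⁻¹ * (g (x + (a : UnitAddCircle)) + g (x - (a : UnitAddCircle)))

theorem measurable_walkOperator (a : ℝ) {g : UnitAddCircle → ℂ} (hg : Measurable g) :
    Measurable (walkOperator a g) :=
  ((hg.comp (measurable_id.add_const _)).add (hg.comp (measurable_id.sub_const _))).const_mul _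

theorem norm_walkOperator_le (a : ℝ) {g : UnitAddCircle → ℂ} (hg : ∀ x, ‖g x‖ ≤ 1)
    (x : UnitAddCircle) : ‖walkOperator a g x‖ ≤ 1 := by
  have h1 := hg (x + (a : UnitAddCircle))
  have h2 := hg (x - (a : UnitAddCircle))
  have h3 := norm_add_le (g (x + (a : UnitAddCircle))) (g (x - (a : UnitAddCircle)))
  rw [walkOperator, norm_mul, norm_inv, Complex.norm_ofNat]
  linarith

theorem measurable_and_norm_iterate_walkOperator_le (a : ℝ) {g : UnitAddCircle → ℂ}
    (hg : Measurable g) (hg1 : ∀ x, ‖g x‖ ≤ 1) (m : ℕ) :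
    Measurable ((walkOperator a)^[m] g) ∧ ∀ x, ‖(walkOperator a)^[m] g x‖ ≤ 1 := by
  induction m with
  | zero => exact ⟨hg, hg1⟩
  | succ m ih =>
    rw [Function.iterate_succ_apply']
    exact ⟨measurable_walkOperator a ih.1, norm_walkOperator_le a ih.2⟩

theorem integrable_of_norm_le_one {E : Type*} [MeasurableSpace E] (μ : Measure E)
    [IsFiniteMeasure μ] {g : E → ℂ} (hg : Measurable g) (hg1 : ∀ x, ‖g x‖ ≤ 1) : Integrable g μ :=
  .of_bound hg.aestronglyMeasurable 1 (Eventually.of_forall hg1)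

theorem fourierCoeff_walkOperator (a : ℝ) {g : UnitAddCircle → ℂ}
    (hg : Integrable g AddCircle.haarAddCircle) (k : ℤ) :
    fourierCoeff (walkOperator a g) k =
      (Real.cos (2 * Real.pi * (k * a)) : ℂ) * fourierCoeff g k := by
  have h1 : walkOperator a g = fun x => (2⁻¹ : ℂ) *
      ((fun x => g (x + (a : UnitAddCircle))) + fun x => g (x + -(a : UnitAddCircle))) x := by
    ext x; simp [walkOperator, sub_eq_add_neg]
  rw [h1, fourierCoeff.const_mul, fourierCoeff.add (hg.comp_add_right _) (hg.comp_add_right _),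
    Pi.add_apply, fourierCoeff_comp_add_right, fourierCoeff_comp_add_right, ← AddCircle.coe_neg,
    fourier_coe_apply, fourier_coe_apply, Complex.ofReal_cos, Complex.cos]
  push_cast
  rw [show 2 * (Real.pi : ℂ) * Complex.I * k * a / 1 = 2 * Real.pi * (k * a) * Complex.I by ring,
    show 2 * (Real.pi : ℂ) * Complex.I * k * -a / 1 = -(2 * Real.pi * (k * a)) * Complex.I by ring]
  ring

theorem fourierCoeff_iterate_walkOperator (a : ℝ) {g : UnitAddCircle → ℂ} (hg : Measurable g)
    (hg1 : ∀ x, ‖g x‖ ≤ 1) (m : ℕ) (k : ℤ) :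
    fourierCoeff ((walkOperator a)^[m] g) k =
      (Real.cos (2 * Real.pi * (k * a)) : ℂ) ^ m * fourierCoeff g k := by
  induction m with
  | zero => simp
  | succ m ih =>
    obtain ⟨h1, h2⟩ := measurable_and_norm_iterate_walkOperator_le a hg hg1 m
    rw [Function.iterate_succ_apply',
      fourierCoeff_walkOperator a (integrable_of_norm_le_one _ h1 h2), ih, pow_succ' (Complex.ofReal _), mul_assoc (Complex.ofReal _)]

open AddCircle in
/-- Parseval's identity for two functions. -/
theorem hasSum_conj_fourierCoeff_mul_fourierCoeff {f g : UnitAddCircle → ℂ}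
    (hf : MemLp f 2 haarAddCircle) (hg : MemLp g 2 haarAddCircle) :
    HasSum (fun k : ℤ => starRingEnd ℂ (fourierCoeff f k) * fourierCoeff g k)
      (∫ x, starRingEnd ℂ (f x) * g x ∂haarAddCircle) := by
  have h := fourierBasis.hasSum_inner_mul_inner (hf.toLp f) (hg.toLp g)
  rw [L2.inner_def] at h
  have e : ∫ x, inner ℂ ((hf.toLp f : UnitAddCircle → ℂ) x) ((hg.toLp g : UnitAddCircle → ℂ) x)
      ∂haarAddCircle = ∫ x, starRingEnd ℂ (f x) * g x ∂haarAddCircle := by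
    refine integral_congr_ae ?_
    filter_upwards [hf.coeFn_toLp, hg.coeFn_toLp] with x h1 h2
    rw [h1, h2, RCLike.inner_apply, mul_comm]
  rw [e] at h
  refine h.congr_fun fun k => ?_
  rw [← inner_conj_symm, ← fourierBasis.repr_apply_apply, ← fourierBasis.repr_apply_apply,
    fourierBasis_repr, fourierBasis_repr, fourierCoeff_congr_ae hf.coeFn_toLp,
    fourierCoeff_congr_ae hg.coeFn_toLp]

/-- The indicator of a set, with complex values. -/
noncomputable def complexIndicator {E : Type*} (A : Set E) : E → ℂ := A.indicator fun _ => 1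

theorem measurable_complexIndicator {E : Type*} [MeasurableSpace E] {A : Set E}
    (hA : MeasurableSet A) : Measurable (complexIndicator A) := measurable_const.indicator hA

theorem norm_complexIndicator_le {E : Type*} (A : Set E) (x : E) : ‖complexIndicator A x‖ ≤ 1 := by
  by_cases h : x ∈ A <;> simp [complexIndicator, h]

theorem memLp_of_norm_le_one {E : Type*} [MeasurableSpace E] (μ : Measure E)
    [IsFiniteMeasure μ] {g : E → ℂ} (hg : Measurable g) (hg1 : ∀ x, ‖g x‖ ≤ 1) : MemLp g 2 μ :=
  .of_bound hg.aestronglyMeasurable 1 (Eventually.of_forall hg1)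

theorem fourierCoeff_complexIndicator_zero {A : Set UnitAddCircle} (hA : MeasurableSet A) :
    fourierCoeff (complexIndicator A) 0 = (AddCircle.haarAddCircle.real A : ℂ) := by
  simp [fourierCoeff, complexIndicator, integral_indicator_const, hA]

/-- The mode `0` of Parseval's identity is the product of the measures, and the other modes decay
at the rate `|cos (2 π k a)| ^ m`. -/
theorem norm_setIntegral_iterate_walkOperator_sub_le (a : ℝ) (m : ℕ) {A A' : Set UnitAddCircle}
    (hA : MeasurableSet A) (hA' : MeasurableSet A')
    (hcA : ∀ k : ℤ, k ≠ 0 → ‖fourierCoeff (complexIndicator A) k‖ ≤ 1 / |(k : ℝ)|)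
    (hcA' : ∀ k : ℤ, k ≠ 0 → ‖fourierCoeff (complexIndicator A') k‖ ≤ 1 / |(k : ℝ)|) :
    ‖∫ x in A, (walkOperator a)^[m] (complexIndicator A') x ∂AddCircle.haarAddCircle -
      (AddCircle.haarAddCircle.real A : ℂ) * (AddCircle.haarAddCircle.real A' : ℂ)‖ ≤
      correlationBound a m := by
  obtain ⟨h1, h2⟩ := measurable_and_norm_iterate_walkOperator_le a
    (measurable_complexIndicator hA') (norm_complexIndicator_le A') m
  have h := hasSum_conj_fourierCoeff_mul_fourierCoeff
    (memLp_of_norm_le_one _ (measurable_complexIndicator hA) (norm_complexIndicator_le A))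
    (memLp_of_norm_le_one _ h1 h2)
  have e : ∫ x, starRingEnd ℂ (complexIndicator A x) *
      (walkOperator a)^[m] (complexIndicator A') x ∂AddCircle.haarAddCircle =
      ∫ x in A, (walkOperator a)^[m] (complexIndicator A') x ∂AddCircle.haarAddCircle := by
    rw [← integral_indicator hA]
    refine integral_congr_ae (Eventually.of_forall fun x => ?_)
    by_cases hx : x ∈ A <;> simp [complexIndicator, hx]
  rw [e] at h
  simp_rw [fourierCoeff_iterate_walkOperator a (measurable_complexIndicator hA')
    (norm_complexIndicator_le A')] at h
  have h0 := h.update 0 0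
  simp only [fourierCoeff_complexIndicator_zero hA, fourierCoeff_complexIndicator_zero hA',
    Int.cast_zero, zero_mul, mul_zero, Real.cos_zero, Complex.ofReal_one, one_pow, one_mul,
    Complex.conj_ofReal, zero_sub, neg_add_eq_sub] at h0
  rw [← h0.tsum_eq]
  refine tsum_of_norm_bounded (summable_correlationBound a m).hasSum fun k => ?_
  rcases eq_or_ne k 0 with rfl | hk
  · simp
  · rw [Function.update_of_ne hk, norm_mul, norm_mul, norm_pow, Complex.norm_real, RCLike.norm_conj,
      Real.norm_eq_abs]
    calc _ ≤ 1 / |(k : ℝ)| * (|Real.cos (2 * Real.pi * (k * a))| ^ m * (1 / |(k : ℝ)|)) := by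
          gcongr
          exacts [hcA k hk, hcA' k hk]
      _ = _ := by rw [← sq_abs (k : ℝ)]; ring

/-! ### Arcs -/

/-- The arc of length `ℓ` that starts at `s`, counterclockwise. -/
def circleArc (s ℓ : ℝ) : Set UnitAddCircle :=
  {x | x - (s : UnitAddCircle) ∈ (fun y : ℝ => (y : UnitAddCircle)) '' Set.Icc 0 ℓ}

theorem measurableSet_circleArc (s ℓ : ℝ) : MeasurableSet (circleArc s ℓ) := by
  have h : IsCompact ((fun y : ℝ => (y : UnitAddCircle)) '' Set.Icc 0 ℓ) :=
    isCompact_Icc.image (AddCircle.continuous_mk' 1)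
  exact measurable_id.sub_const _ h.isClosed.measurableSet

theorem circleArc_eq_preimage (s ℓ : ℝ) :
    circleArc s ℓ = (fun x => x + -(s : UnitAddCircle)) ⁻¹' circleArc 0 ℓ := by
  ext x
  simp [circleArc, sub_eq_add_neg]

theorem circleArc_eq_univ (s : ℝ) {ℓ : ℝ} (hℓ : 1 ≤ ℓ) : circleArc s ℓ = Set.univ := by
  refine Set.eq_univ_of_forall fun x => ?_
  obtain ⟨y, hy, hyx⟩ : x - (s : UnitAddCircle) ∈ (fun y : ℝ => (y : UnitAddCircle)) ''
      Set.Icc 0 (0 + 1) := by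
    rw [AddCircle.coe_image_Icc_eq]; trivial
  exact ⟨y, ⟨hy.1, hy.2.trans (by linarith)⟩, hyx⟩

theorem fourierCoeff_circleArc_zero_eq {ℓ : ℝ} (hℓ : 0 ≤ ℓ) (hℓ1 : ℓ ≤ 1) (k : ℤ) :
    fourierCoeff (complexIndicator (circleArc 0 ℓ)) k =
      ∫ x in (0 : ℝ)..ℓ, Complex.exp (-(2 * Real.pi * Complex.I * k) * x) := by
  rw [fourierCoeff_eq_intervalIntegral _ _ 0, div_one, one_smul, zero_add,
    intervalIntegral.integral_of_le hℓ, intervalIntegral.integral_of_le zero_le_one,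
    integral_Ioc_eq_integral_Ioo]
  have h : ∀ x ∈ Set.Ioo (0 : ℝ) 1, fourier (-k) (x : UnitAddCircle) •
      complexIndicator (circleArc 0 ℓ) (x : UnitAddCircle) =
      (Set.Iic ℓ).indicator (fun x : ℝ => Complex.exp (-(2 * Real.pi * Complex.I * k) * x)) x := by
    intro x hx
    have hmem : (x : UnitAddCircle) ∈ circleArc 0 ℓ ↔ x ∈ Set.Iic ℓ := by
      constructor
      · rintro ⟨y, hy, hyx⟩
        rw [AddCircle.coe_zero, sub_zero] at hyx
        rw [← sub_eq_zero, ← AddCircle.coe_sub, AddCircle.coe_eq_zero_iff] at hyx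
        obtain ⟨n, hn⟩ := hyx
        rw [zsmul_one] at hn
        have h1 : (-1 : ℝ) < n := by linarith [hy.1, hx.2]
        have h2 : (n : ℝ) < 1 := by linarith [hy.2, hx.1]
        have h3 : n = 0 := by
          have h1' : -1 < n := by exact_mod_cast h1
          have h2' : n < 1 := by exact_mod_cast h2
          omega
        rw [h3, Int.cast_zero] at hn
        exact Set.mem_Iic.2 (by linarith [hy.2])
      · intro h
        exact ⟨x, ⟨hx.1.le, h⟩, by simp⟩
    by_cases hxℓ : x ∈ Set.Iic ℓ
    · rw [complexIndicator, Set.indicator_of_mem (hmem.2 hxℓ), Set.indicator_of_mem hxℓ,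
        fourier_coe_apply, smul_eq_mul, mul_one]
      push_cast
      ring_nf
    · rw [complexIndicator, Set.indicator_of_notMem (mt hmem.1 hxℓ), Set.indicator_of_notMem hxℓ,
        smul_zero]
  rw [setIntegral_congr_fun measurableSet_Ioo h, ← integral_Ioc_eq_integral_Ioo,
    setIntegral_indicator measurableSet_Iic]
  congr 2
  ext x
  simp only [Set.mem_inter_iff, Set.mem_Ioc, Set.mem_Iic]
  exact ⟨fun h => ⟨h.1.1, h.2⟩, fun h => ⟨⟨h.1, h.2.trans hℓ1⟩, h.2⟩⟩

theorem norm_fourierCoeff_circleArc_le (s : ℝ) {ℓ : ℝ} (hℓ : 0 ≤ ℓ) (hℓ1 : ℓ ≤ 1) {k : ℤ}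
    (hk : k ≠ 0) : ‖fourierCoeff (complexIndicator (circleArc s ℓ)) k‖ ≤ 1 / |(k : ℝ)| := by
  have h1 : complexIndicator (circleArc s ℓ) =
      fun x => complexIndicator (circleArc 0 ℓ) (x + -(s : UnitAddCircle)) := by
    rw [circleArc_eq_preimage]
    rfl
  have h2 : ‖fourier k (-(s : UnitAddCircle))‖ = 1 := Circle.norm_coe _
  rw [h1, fourierCoeff_comp_add_right, norm_mul, h2, one_mul, fourierCoeff_circleArc_zero_eq hℓ hℓ1]
  have hc : -(2 * Real.pi * Complex.I * k) ≠ 0 := by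
    simp [Real.pi_ne_zero, hk]
  rw [integral_exp_mul_complex hc, norm_div, norm_neg]
  have he : ∀ x : ℝ, ‖Complex.exp (-(2 * Real.pi * Complex.I * k) * x)‖ = 1 := by
    intro x
    rw [← Complex.norm_exp_ofReal_mul_I (-(2 * Real.pi * k * x))]
    push_cast
    ring_nf
  have hk0 : 0 < |(k : ℝ)| := abs_pos.2 (by exact_mod_cast hk)
  have h3 : ‖2 * Real.pi * Complex.I * (k : ℂ)‖ = 2 * Real.pi * |(k : ℝ)| := by
    simp [abs_of_pos Real.pi_pos]
  have h4 := norm_sub_le (Complex.exp (-(2 * Real.pi * Complex.I * k) * ℓ))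
    (Complex.exp (-(2 * Real.pi * Complex.I * k) * (0 : ℝ)))
  rw [he, he] at h4
  rw [h3, div_le_div_iff₀ (by positivity) hk0]
  nlinarith [Real.pi_gt_three]

theorem haarAddCircle_real_circleArc (s : ℝ) {ℓ : ℝ} (hℓ : 0 ≤ ℓ) (hℓ1 : ℓ ≤ 1) :
    AddCircle.haarAddCircle.real (circleArc s ℓ) = ℓ := by
  rw [circleArc_eq_preimage, measureReal_def, measure_preimage_add_right, ← measureReal_def,
    ← Complex.ofReal_inj, ← fourierCoeff_complexIndicator_zero (measurableSet_circleArc 0 ℓ),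
    fourierCoeff_circleArc_zero_eq hℓ hℓ1]
  simp

/-! ### Covariances of the walk -/

section Walk

variable {Ω : Type*} [MeasurableSpace Ω] {P : Measure Ω} [IsProbabilityMeasure P] {a : ℝ}
  {X : ℕ → Ω → UnitAddCircle}

/-- The Markov property, integrated over an event of the past. -/
theorem IsStationaryMarkovChain.setIntegral_comp_succ
    (hX : IsStationaryMarkovChain P (circleWalkKernel a) AddCircle.haarAddCircle X) {n : ℕ}
    {B : Set Ω}
    (hB : MeasurableSet[⨆ i ∈ Set.Iic n, MeasurableSpace.comap (X i) inferInstance] B)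
    {g : UnitAddCircle → ℂ} (hg : Measurable g) (hg1 : ∀ x, ‖g x‖ ≤ 1) :
    ∫ ω in B, g (X (n + 1) ω) ∂P = ∫ ω in B, walkOperator a g (X n ω) ∂P := by
  have hle : ⨆ i ∈ Set.Iic n, MeasurableSpace.comap (X i) inferInstance ≤
      (inferInstance : MeasurableSpace Ω) := iSup₂_le fun i _ => (hX.measurable i).comap_le
  have hB' : MeasurableSet B := hle B hB
  have hp : Measurable fun ω => X n ω + (a : UnitAddCircle) := (hX.measurable n).add_const _
  have hm : Measurable fun ω => X n ω - (a : UnitAddCircle) := (hX.measurable n).sub_const _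
  -- The conditional law of the next position, as an identity of measures on the circle.
  have hlaw : (P.restrict B).map (X (n + 1)) =
      (2⁻¹ : ℝ≥0∞) • ((P.restrict B).map (fun ω => X n ω + (a : UnitAddCircle)) +
        (P.restrict B).map fun ω => X n ω - (a : UnitAddCircle)) := by
    ext A hA
    have h1 := setIntegral_condExp hle
      ((integrable_const (1 : ℝ)).indicator (hX.measurable (n + 1) hA)) (μ := P) hB
    rw [setIntegral_congr_ae hB' ((hX.markov n A hA).mono fun _ h _ => h)] at h1
    have h2 : ∀ ω, (circleWalkKernel a (X n ω)).real A =
        2⁻¹ * ((((fun ω => X n ω + (a : UnitAddCircle)) ⁻¹' A).indicator (fun _ => (1 : ℝ)) ω) +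
          ((fun ω => X n ω - (a : UnitAddCircle)) ⁻¹' A).indicator (fun _ => (1 : ℝ)) ω) := by
      intro ω
      change ((2⁻¹ : ℝ≥0∞) • (Measure.dirac _ + Measure.dirac _) : Measure _).real A = _
      rw [measureReal_ennreal_smul_apply, measureReal_add_apply, measureReal_def, measureReal_def,
        Measure.dirac_apply' _ hA, Measure.dirac_apply' _ hA]
      by_cases h3 : X n ω + (a : UnitAddCircle) ∈ A <;>
        by_cases h4 : X n ω - (a : UnitAddCircle) ∈ A <;> simp [Set.indicator, h3, h4]
    simp_rw [h2] at h1
    rw [integral_const_mul, integral_add ((integrable_const _).indicator (hp hA))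
      ((integrable_const _).indicator (hm hA)), integral_indicator_const _ (hp hA),
      integral_indicator_const _ (hm hA),
      integral_indicator_const _ (hX.measurable (n + 1) hA)] at h1
    simp only [smul_eq_mul, mul_one] at h1
    have htop : ((2⁻¹ : ℝ≥0∞) • ((P.restrict B).map (fun ω => X n ω + (a : UnitAddCircle)) +
        (P.restrict B).map fun ω => X n ω - (a : UnitAddCircle))) A ≠ ∞ :=
      ENNReal.mul_ne_top (by simp) (measure_ne_top _ _)
    rw [← measureReal_eq_measureReal_iff (h₂ := htop), measureReal_ennreal_smul_apply,
      measureReal_add_apply, map_measureReal_apply (hX.measurable _) hA, map_measureReal_apply hp hA,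
      map_measureReal_apply hm hA, ← h1]
    simp
  calc ∫ ω in B, g (X (n + 1) ω) ∂P
      = ∫ x, g x ∂((P.restrict B).map (X (n + 1))) :=
        (integral_map (hX.measurable _).aemeasurable hg.aestronglyMeasurable).symm
    _ = 2⁻¹ * (∫ ω in B, g (X n ω + (a : UnitAddCircle)) ∂P +
          ∫ ω in B, g (X n ω - (a : UnitAddCircle)) ∂P) := by
        rw [hlaw, integral_smul_measure, integral_add_measure (integrable_of_norm_le_one _ hg hg1)
          (integrable_of_norm_le_one _ hg hg1),
          integral_map hp.aemeasurable hg.aestronglyMeasurable,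
          integral_map hm.aemeasurable hg.aestronglyMeasurable]
        simp [mul_add]
    _ = ∫ ω in B, walkOperator a g (X n ω) ∂P := by
        simp only [walkOperator]
        rw [integral_const_mul, integral_add]
        · exact integrable_of_norm_le_one _ (hg.comp hp) fun _ => hg1 _
        · exact integrable_of_norm_le_one _ (hg.comp hm) fun _ => hg1 _

theorem IsStationaryMarkovChain.setIntegral_comp_add
    (hX : IsStationaryMarkovChain P (circleWalkKernel a) AddCircle.haarAddCircle X) (i m : ℕ)
    {A : Set UnitAddCircle} (hA : MeasurableSet A) {g : UnitAddCircle → ℂ} (hg : Measurable g)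
    (hg1 : ∀ x, ‖g x‖ ≤ 1) :
    ∫ ω in X i ⁻¹' A, g (X (i + m) ω) ∂P =
      ∫ x in A, (walkOperator a)^[m] g x ∂AddCircle.haarAddCircle := by
  induction m generalizing g with
  | zero =>
    rw [← hX.law i]
    exact (setIntegral_map hA hg.aestronglyMeasurable (hX.measurable i).aemeasurable).symm
  | succ m ih =>
    have hpast : MeasurableSet[⨆ j ∈ Set.Iic (i + m), MeasurableSpace.comap (X j) inferInstance]
        (X i ⁻¹' A) := by
      have h : MeasurableSpace.comap (X i) inferInstance ≤
          ⨆ j ∈ Set.Iic (i + m), MeasurableSpace.comap (X j) inferInstance :=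
        le_iSup₂_of_le i (Set.mem_Iic.2 (Nat.le_add_right i m)) le_rfl
      exact h _ ⟨A, hA, rfl⟩
    rw [← add_assoc, hX.setIntegral_comp_succ hpast hg hg1, ih (measurable_walkOperator a hg)
      (norm_walkOperator_le a hg1), Function.iterate_succ_apply]

/-- The covariance bound: the joint law of the positions at times `i` and `i + m` is expressed by
the `m`-th power of the transition operator. -/
theorem IsStationaryMarkovChain.abs_measureReal_inter_sub_le
    (hX : IsStationaryMarkovChain P (circleWalkKernel a) AddCircle.haarAddCircle X) (i m : ℕ)
    {A A' : Set UnitAddCircle} (hA : MeasurableSet A) (hA' : MeasurableSet A')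
    (hcA : ∀ k : ℤ, k ≠ 0 → ‖fourierCoeff (complexIndicator A) k‖ ≤ 1 / |(k : ℝ)|)
    (hcA' : ∀ k : ℤ, k ≠ 0 → ‖fourierCoeff (complexIndicator A') k‖ ≤ 1 / |(k : ℝ)|) :
    |P.real (X i ⁻¹' A ∩ X (i + m) ⁻¹' A') - P.real (X i ⁻¹' A) * P.real (X (i + m) ⁻¹' A')| ≤
      correlationBound a m := by
  have hreal : ∀ (n : ℕ) {D : Set UnitAddCircle}, MeasurableSet D →
      P.real (X n ⁻¹' D) = AddCircle.haarAddCircle.real D := fun n D hD => by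
    rw [← hX.law n, map_measureReal_apply (hX.measurable n) hD]
  have h := norm_setIntegral_iterate_walkOperator_sub_le a m hA hA' hcA hcA'
  rw [← hX.setIntegral_comp_add i m hA (measurable_complexIndicator hA')
    (norm_complexIndicator_le A')] at h
  have e : ∫ ω in X i ⁻¹' A, complexIndicator A' (X (i + m) ω) ∂P =
      (P.real (X i ⁻¹' A ∩ X (i + m) ⁻¹' A') : ℂ) := by
    change ∫ ω in X i ⁻¹' A, (X (i + m) ⁻¹' A').indicator (fun _ => (1 : ℂ)) ω ∂P = _
    rw [integral_indicator_const _ (hX.measurable _ hA'),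
      measureReal_restrict_apply (hX.measurable _ hA'), Set.inter_comm]
    simp
  rwa [e, ← hreal i hA, ← hreal (i + m) hA', ← Complex.ofReal_mul, ← Complex.ofReal_sub,
    Complex.norm_real] at h

end Walk

/-! ### A strong Borel-Cantelli criterion -/

theorem ae_tendsto_zero_of_summable_integral_sq {Ω : Type*} [MeasurableSpace Ω] {P : Measure Ω}
    {D : ℕ → Ω → ℝ} (hD : ∀ j, Measurable (D j)) (hint : ∀ j, Integrable (fun ω => D j ω ^ 2) P)
    (hsum : Summable fun j => ∫ ω, D j ω ^ 2 ∂P) :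
    ∀ᵐ ω ∂P, Tendsto (fun j => D j ω) atTop (𝓝 0) := by
  have hmeas : ∀ j, Measurable fun ω => ENNReal.ofReal (D j ω ^ 2) := fun j =>
    ((hD j).pow_const 2).ennreal_ofReal
  have h1 : ∫⁻ ω, ∑' j, ENNReal.ofReal (D j ω ^ 2) ∂P ≠ ∞ := by
    rw [lintegral_tsum fun j => (hmeas j).aemeasurable]
    have h2 : ∀ j, ∫⁻ ω, ENNReal.ofReal (D j ω ^ 2) ∂P = ENNReal.ofReal (∫ ω, D j ω ^ 2 ∂P) :=
      fun j => (ofReal_integral_eq_lintegral_ofReal (hint j)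
        (Eventually.of_forall fun _ => sq_nonneg _)).symm
    simp_rw [h2]
    exact hsum.tsum_ofReal_ne_top
  filter_upwards [ae_lt_top (Measurable.tsum hmeas) h1] with ω hω
  have h3 := ENNReal.tendsto_atTop_zero_of_tsum_ne_top hω.ne
  have h4 : Tendsto (fun j => D j ω ^ 2) atTop (𝓝 0) := by
    have h5 := (ENNReal.tendsto_toReal ENNReal.zero_ne_top).comp h3
    simpa [Function.comp_def, ENNReal.toReal_ofReal (sq_nonneg _)] using h5
  have h6 := h4.sqrt
  simp_rw [Real.sqrt_sq_eq_abs, Real.sqrt_zero] at h6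
  exact (tendsto_zero_iff_abs_tendsto_zero _).2 h6

/-- A ratio of monotone sequences converges as soon as it does along the `K`-th powers, if the
denominator is asymptotically constant between consecutive `K`-th powers. -/
theorem tendsto_div_of_tendsto_div_pow {s e : ℕ → ℝ} (hs : Monotone s) (hs0 : ∀ n, 0 ≤ s n)
    (he : Monotone e) (he0 : ∀ n, 1 ≤ n → 0 < e n) {K : ℕ} (hK : K ≠ 0)
    (hratio : Tendsto (fun j : ℕ => e ((j + 1) ^ K) / e (j ^ K)) atTop (𝓝 1))
    (hsub : Tendsto (fun j : ℕ => s (j ^ K) / e (j ^ K)) atTop (𝓝 1)) :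
    Tendsto (fun n => s n / e n) atTop (𝓝 1) := by
  -- `J n` is the integer part of the `K`-th root of `n`.
  set J : ℕ → ℕ := fun n => Nat.findGreatest (fun j => j ^ K ≤ n) n with hJ
  have hJle : ∀ n, J n ^ K ≤ n := fun n =>
    Nat.findGreatest_spec (P := fun j => j ^ K ≤ n) (Nat.zero_le n) (by simp [hK])
  have hJlt : ∀ n, n < (J n + 1) ^ K := by
    intro n
    by_contra! h
    have h1 : J n + 1 ≤ J n :=
      Nat.le_findGreatest (P := fun j => j ^ K ≤ n) ((Nat.le_self_pow hK _).trans h) h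
    omega
  have hJtop : Tendsto J atTop atTop := by
    refine tendsto_atTop.2 fun N => ?_
    filter_upwards [eventually_ge_atTop (N ^ K)] with n hn
    exact Nat.le_findGreatest (P := fun j => j ^ K ≤ n) ((Nat.le_self_pow hK _).trans hn) hn
  have hlow : Tendsto (fun j : ℕ => s (j ^ K) / e ((j + 1) ^ K)) atTop (𝓝 1) := by
    have h := hsub.mul (hratio.inv₀ one_ne_zero)
    rw [inv_one, mul_one] at h
    refine h.congr' ?_
    filter_upwards [eventually_ge_atTop 1] with j hj
    have h1 := he0 (j ^ K) (Nat.one_le_pow _ _ hj)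
    have h2 := he0 ((j + 1) ^ K) (Nat.one_le_pow _ _ (by omega))
    field_simp
  have hup : Tendsto (fun j : ℕ => s ((j + 1) ^ K) / e (j ^ K)) atTop (𝓝 1) := by
    have h := ((tendsto_add_atTop_iff_nat 1).2 hsub).mul hratio
    rw [mul_one] at h
    refine h.congr' ?_
    filter_upwards [eventually_ge_atTop 1] with j hj
    have h1 := he0 (j ^ K) (Nat.one_le_pow _ _ hj)
    have h2 := he0 ((j + 1) ^ K) (Nat.one_le_pow _ _ (by omega))
    field_simp
  refine tendsto_of_tendsto_of_tendsto_of_le_of_le' (hlow.comp hJtop) (hup.comp hJtop) ?_ ?_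
  · filter_upwards [eventually_ge_atTop 1] with n hn
    exact div_le_div₀ (hs0 _) (hs (hJle n)) (he0 n hn) (he (hJlt n).le)
  · filter_upwards [hJtop.eventually_ge_atTop 1] with n hn
    exact div_le_div₀ (hs0 _) (hs (hJlt n).le) (he0 _ (Nat.one_le_pow _ _ hn)) (he (hJle n))

/-- The partial sums of the series `∑ k ^ (-δ)`. -/
noncomputable def powerSum (δ : ℝ) (n : ℕ) : ℝ := ∑ k ∈ Finset.Icc 1 n, (k : ℝ) ^ (-δ)

theorem monotone_powerSum (δ : ℝ) : Monotone (powerSum δ) := fun m n hmn =>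
  Finset.sum_le_sum_of_subset_of_nonneg (Finset.Icc_subset_Icc_right hmn)
    fun _ _ _ => by positivity

theorem mul_rpow_le_powerSum {δ : ℝ} (hδ : 0 ≤ δ) (n : ℕ) : n * (n : ℝ) ^ (-δ) ≤ powerSum δ n := by
  have h : ∀ k ∈ Finset.Icc 1 n, (n : ℝ) ^ (-δ) ≤ (k : ℝ) ^ (-δ) := by
    intro k hk
    rw [Finset.mem_Icc] at hk
    exact Real.rpow_le_rpow_of_nonpos (by exact_mod_cast hk.1) (by exact_mod_cast hk.2)
      (by linarith)
  simpa [powerSum] using Finset.card_nsmul_le_sum _ _ _ h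

theorem powerSum_pos {δ : ℝ} (hδ : 0 ≤ δ) {n : ℕ} (hn : 1 ≤ n) : 0 < powerSum δ n := by
  have : (0 : ℝ) < n := by exact_mod_cast hn
  exact lt_of_lt_of_le (by positivity) (mul_rpow_le_powerSum hδ n)

/-- The means of an antitone sequence are antitone. -/
theorem powerSum_le_div_mul {δ : ℝ} (hδ : 0 ≤ δ) {m n : ℕ} (hm : 1 ≤ m) (hmn : m ≤ n) :
    powerSum δ n ≤ n / m * powerSum δ m := by
  have hm' : (0 : ℝ) < m := by exact_mod_cast hm
  induction n, hmn using Nat.le_induction with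
  | base => rw [div_self hm'.ne', one_mul]
  | succ n hmn ih =>
    have h1 : ((n + 1 : ℕ) : ℝ) ^ (-δ) ≤ powerSum δ m / m := by
      rw [le_div_iff₀ hm', mul_comm]
      refine le_trans ?_ (mul_rpow_le_powerSum hδ m)
      refine mul_le_mul_of_nonneg_left (Real.rpow_le_rpow_of_nonpos hm' ?_ (by linarith)) hm'.le
      exact_mod_cast hmn.trans (Nat.le_succ n)
    rw [powerSum, Finset.sum_Icc_succ_top (by omega)]
    calc _ ≤ n / m * powerSum δ m + powerSum δ m / m := add_le_add ih h1
      _ = _ := by push_cast; ring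

theorem tendsto_powerSum_ratio {δ : ℝ} (hδ : 0 ≤ δ) (K : ℕ) :
    Tendsto (fun j : ℕ => powerSum δ ((j + 1) ^ K) / powerSum δ (j ^ K)) atTop (𝓝 1) := by
  have h : Tendsto (fun j : ℕ => (((j : ℝ) + 1) / j) ^ K) atTop (𝓝 1) := by
    have h1 : Tendsto (fun j : ℕ => (1 + ((j : ℝ))⁻¹) ^ K) atTop (𝓝 ((1 + 0) ^ K)) :=
      (tendsto_const_nhds.add tendsto_inv_atTop_nhds_zero_nat).pow K
    rw [add_zero, one_pow] at h1
    refine h1.congr' ?_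
    filter_upwards [eventually_ge_atTop 1] with j hj
    have : (j : ℝ) ≠ 0 := by exact_mod_cast (by omega : j ≠ 0)
    field_simp
  refine tendsto_of_tendsto_of_tendsto_of_le_of_le' tendsto_const_nhds h ?_ ?_
  · filter_upwards [eventually_ge_atTop 1] with j hj
    rw [one_le_div (powerSum_pos hδ (Nat.one_le_pow _ _ hj))]
    exact monotone_powerSum δ (Nat.pow_le_pow_left (Nat.le_succ j) K)
  · filter_upwards [eventually_ge_atTop 1] with j hj
    rw [div_le_iff₀ (powerSum_pos hδ (Nat.one_le_pow _ _ hj)), div_pow]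
    exact_mod_cast powerSum_le_div_mul hδ (Nat.one_le_pow K j hj)
      (Nat.pow_le_pow_left (Nat.le_succ j) K)

theorem eventCount_nonneg {Ω : Type*} (B : ℕ → Set Ω) (n : ℕ) (ω : Ω) : 0 ≤ eventCount B n ω :=
  Finset.sum_nonneg fun _ _ => Set.indicator_nonneg (fun _ _ => zero_le_one) _

theorem monotone_eventCount {Ω : Type*} (B : ℕ → Set Ω) (ω : Ω) :
    Monotone fun n => eventCount B n ω := fun _ _ hmn =>
  Finset.sum_le_sum_of_subset_of_nonneg (Finset.Icc_subset_Icc_right hmn)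
    fun _ _ _ => Set.indicator_nonneg (fun _ _ => zero_le_one) _

section Criterion

variable {Ω : Type*} [MeasurableSpace Ω] {P : Measure Ω} [IsProbabilityMeasure P] {B : ℕ → Set Ω}

theorem measurable_eventCount (hB : ∀ k, 1 ≤ k → MeasurableSet (B k)) (n : ℕ) :
    Measurable (eventCount B n) :=
  Finset.measurable_fun_sum _ fun k hk =>
    measurable_const.indicator (hB k (Finset.mem_Icc.1 hk).1)

theorem integral_eventCount (hB : ∀ k, 1 ≤ k → MeasurableSet (B k)) (n : ℕ) :
    ∫ ω, eventCount B n ω ∂P = ∑ k ∈ Finset.Icc 1 n, P.real (B k) := by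
  simp only [eventCount]
  rw [integral_finsetSum _ fun k hk =>
    (integrable_const _).indicator (hB k (Finset.mem_Icc.1 hk).1)]
  refine Finset.sum_congr rfl fun k hk => ?_
  rw [integral_indicator_const _ (hB k (Finset.mem_Icc.1 hk).1), smul_eq_mul, mul_one]

theorem integral_indicator_sub_mul_indicator_sub {A A' : Set Ω} (hA : MeasurableSet A)
    (hA' : MeasurableSet A') :
    ∫ ω, (A.indicator (fun _ => (1 : ℝ)) ω - P.real A) *
        (A'.indicator (fun _ => (1 : ℝ)) ω - P.real A') ∂P =
      P.real (A ∩ A') - P.real A * P.real A' := by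
  have hi : ∀ {D : Set Ω}, MeasurableSet D → Integrable (D.indicator fun _ => (1 : ℝ)) P :=
    fun hD => (integrable_const _).indicator hD
  have e : ∀ ω, (A.indicator (fun _ => (1 : ℝ)) ω - P.real A) *
        (A'.indicator (fun _ => (1 : ℝ)) ω - P.real A') =
      (A ∩ A').indicator (fun _ => (1 : ℝ)) ω - P.real A' * A.indicator (fun _ => (1 : ℝ)) ω -
        P.real A * A'.indicator (fun _ => (1 : ℝ)) ω + P.real A * P.real A' := by
    intro ω
    by_cases h1 : ω ∈ A <;> by_cases h2 : ω ∈ A' <;> simp [h1, h2] <;> ring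
  simp_rw [e]
  have i1 := hi (hA.inter hA')
  have i2 := (hi hA).const_mul (P.real A')
  have i3 := (hi hA').const_mul (P.real A)
  rw [integral_add ((i1.sub' i2).sub' i3) (integrable_const _), integral_sub (i1.sub' i2) i3,
    integral_sub i1 i2,
    integral_const_mul, integral_const_mul, integral_indicator_const _ (hA.inter hA'),
    integral_indicator_const _ hA, integral_indicator_const _ hA']
  simp
  ring

/-- Each distance `m < n` from `i` is attained at most twice. -/
theorem sum_dist_le_two_mul_sum_range {r : ℕ → ℝ} (hr : ∀ m, 0 ≤ r m) {n i : ℕ}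
    (hi : i ∈ Finset.Icc 1 n) :
    ∑ j ∈ Finset.Icc 1 n, r (Nat.dist i j) ≤ 2 * ∑ m ∈ Finset.range n, r m := by
  rw [Finset.mem_Icc] at hi
  rw [← Finset.sum_filter_add_sum_filter_not _ (fun j => i ≤ j), two_mul]
  have key : ∀ s ⊆ Finset.Icc 1 n, Set.InjOn (Nat.dist i) (s : Set ℕ) →
      ∑ j ∈ s, r (Nat.dist i j) ≤ ∑ m ∈ Finset.range n, r m := by
    intro s hs hinj
    rw [← Finset.sum_image (f := r) hinj]
    refine Finset.sum_le_sum_of_subset_of_nonneg (fun m hm => ?_) fun _ _ _ => hr _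
    obtain ⟨j, hj, rfl⟩ := Finset.mem_image.1 hm
    have := Finset.mem_Icc.1 (hs hj)
    rw [Finset.mem_range, Nat.dist]
    omega
  refine add_le_add (key _ (Finset.filter_subset _ _) ?_) (key _ (Finset.filter_subset _ _) ?_) <;>
  · intro j hj l hl hjl
    simp only [Finset.coe_filter, Set.mem_ofPred_eq, Nat.dist] at hj hl hjl
    omega

theorem integral_eventCount_sub_sq_le (hB : ∀ k, 1 ≤ k → MeasurableSet (B k)) {r : ℕ → ℝ}
    (hr : ∀ m, 0 ≤ r m)
    (hcov : ∀ i m, 1 ≤ i → |P.real (B i ∩ B (i + m)) - P.real (B i) * P.real (B (i + m))| ≤ r m)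
    (n : ℕ) :
    ∫ ω, (eventCount B n ω - ∑ k ∈ Finset.Icc 1 n, P.real (B k)) ^ 2 ∂P ≤
      2 * n * ∑ m ∈ Finset.range n, r m := by
  have e : ∀ ω, (eventCount B n ω - ∑ k ∈ Finset.Icc 1 n, P.real (B k)) ^ 2 =
      ∑ i ∈ Finset.Icc 1 n, ∑ j ∈ Finset.Icc 1 n,
        ((B i).indicator (fun _ => (1 : ℝ)) ω - P.real (B i)) *
          ((B j).indicator (fun _ => (1 : ℝ)) ω - P.real (B j)) := by
    intro ω
    rw [eventCount, ← Finset.sum_sub_distrib, sq, Finset.sum_mul_sum]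
  have hm : ∀ k ∈ Finset.Icc 1 n, MeasurableSet (B k) := fun k hk => hB k (Finset.mem_Icc.1 hk).1
  have hmeas : ∀ k ∈ Finset.Icc 1 n,
      Measurable fun ω => (B k).indicator (fun _ => (1 : ℝ)) ω - P.real (B k) := fun k hk =>
    (measurable_const.indicator (hm k hk)).sub_const _
  have hbd : ∀ k ω, ‖(B k).indicator (fun _ => (1 : ℝ)) ω - P.real (B k)‖ ≤ 1 := by
    intro k ω
    have h1 : P.real (B k) ≤ 1 := measureReal_le_one
    have h2 : 0 ≤ P.real (B k) := measureReal_nonneg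
    rw [Real.norm_eq_abs, abs_le]
    by_cases h : ω ∈ B k <;> simp only [h, Set.indicator_of_mem, Set.indicator_of_notMem,
      not_false_eq_true] <;> constructor <;> linarith
  have hint : ∀ i ∈ Finset.Icc 1 n, ∀ j ∈ Finset.Icc 1 n, Integrable (fun ω =>
      ((B i).indicator (fun _ => (1 : ℝ)) ω - P.real (B i)) *
        ((B j).indicator (fun _ => (1 : ℝ)) ω - P.real (B j))) P := by
    intro i hi j hj
    refine .of_bound ((hmeas i hi).mul (hmeas j hj)).aestronglyMeasurable 1
      (Eventually.of_forall fun ω => ?_)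
    rw [norm_mul]
    exact mul_le_one₀ (hbd i ω) (norm_nonneg _) (hbd j ω)
  have hcov' : ∀ i ∈ Finset.Icc 1 n, ∀ j ∈ Finset.Icc 1 n,
      P.real (B i ∩ B j) - P.real (B i) * P.real (B j) ≤ r (Nat.dist i j) := by
    intro i hi j hj
    rw [Finset.mem_Icc] at hi hj
    rcases le_total i j with h | h
    · have h1 := (le_abs_self _).trans (hcov i (j - i) hi.1)
      rwa [Nat.add_sub_cancel' h, ← Nat.dist_eq_sub_of_le h] at h1
    · have h1 := (le_abs_self _).trans (hcov j (i - j) hj.1)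
      rwa [Nat.add_sub_cancel' h, ← Nat.dist_eq_sub_of_le_right h, Set.inter_comm, mul_comm] at h1
  simp_rw [e]
  rw [integral_finsetSum _ fun i hi => integrable_finsetSum _ (hint i hi)]
  calc _ ≤ ∑ i ∈ Finset.Icc 1 n, 2 * ∑ m ∈ Finset.range n, r m := by
        refine Finset.sum_le_sum fun i hi => ?_
        rw [integral_finsetSum _ (hint i hi)]
        refine le_trans (Finset.sum_le_sum fun j hj => ?_) (sum_dist_le_two_mul_sum_range hr hi)
        rw [integral_indicator_sub_mul_indicator_sub (hm i hi) (hm j hj)]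
        exact hcov' i hi j hj
    _ = _ := by simp; ring

/-- Events of probability `k ^ (-δ)` whose covariances at distance `m` have sums of order `n ^ θ`
are strongly Borel-Cantelli if `2 δ + θ < 1`: the variance of `S n / E n` is then at most a negative
power of `n`, hence summable along the `K`-th powers for a large `K`. -/
theorem isStronglyBorelCantelli_of_covariance_le (hB : ∀ k, 1 ≤ k → MeasurableSet (B k)) {δ : ℝ}
    (hδ : 0 ≤ δ) (hP : ∀ k : ℕ, 1 ≤ k → P.real (B k) = (k : ℝ) ^ (-δ)) {r : ℕ → ℝ}
    (hr : ∀ m, 0 ≤ r m)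
    (hcov : ∀ i m, 1 ≤ i → |P.real (B i ∩ B (i + m)) - P.real (B i) * P.real (B (i + m))| ≤ r m)
    {C θ : ℝ} (hθ : 0 ≤ θ) (hδθ : 2 * δ + θ < 1)
    (hsum : ∀ n : ℕ, ∑ m ∈ Finset.range n, r m ≤ C * (n : ℝ) ^ θ) :
    IsStronglyBorelCantelli P B := by
  have hE : ∀ n, ∑ k ∈ Finset.Icc 1 n, P.real (B k) = powerSum δ n := fun n =>
    Finset.sum_congr rfl fun k hk => hP k (Finset.mem_Icc.1 hk).1
  refine ⟨hB, ?_, ?_⟩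
  · by_contra htop
    have h1 := ENNReal.summable_toReal htop
    have h2 : Summable fun k : ℕ => ((k + 1 : ℕ) : ℝ) ^ (-δ) := h1.congr fun k =>
      hP (k + 1) (Nat.le_add_left 1 k)
    have h3 := Real.summable_nat_rpow.1 ((summable_nat_add_iff 1).1 h2)
    linarith
  set η : ℝ := 1 - (2 * δ + θ) with hη
  have hη0 : 0 < η := by linarith
  obtain ⟨K, hK⟩ := exists_nat_gt (1 / η)
  have hK0 : (0 : ℝ) < K := lt_trans (by positivity) hK
  have hKη : 1 < K * η := (div_lt_iff₀ hη0).1 hK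
  have hvar : ∀ n : ℕ, 1 ≤ n →
      ∫ ω, (eventCount B n ω / powerSum δ n - 1) ^ 2 ∂P ≤ 2 * C * (n : ℝ) ^ (-η) := by
    intro n hn
    have hn' : (0 : ℝ) < n := by exact_mod_cast hn
    have hp := powerSum_pos hδ hn
    have e : ∀ ω, (eventCount B n ω / powerSum δ n - 1) ^ 2 =
        (powerSum δ n ^ 2)⁻¹ * (eventCount B n ω - powerSum δ n) ^ 2 := by
      intro ω
      field_simp
    simp_rw [e]
    rw [integral_const_mul]
    have h1 := integral_eventCount_sub_sq_le hB hr hcov n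
    rw [hE] at h1
    have h2 : (n * (n : ℝ) ^ (-δ)) ^ 2 ≤ powerSum δ n ^ 2 :=
      pow_le_pow_left₀ (by positivity) (mul_rpow_le_powerSum hδ n) 2
    calc (powerSum δ n ^ 2)⁻¹ * ∫ ω, (eventCount B n ω - powerSum δ n) ^ 2 ∂P
        ≤ ((n * (n : ℝ) ^ (-δ)) ^ 2)⁻¹ * (2 * n * (C * (n : ℝ) ^ θ)) := by
          gcongr
          exact h1.trans (by gcongr; exact hsum n)
      _ = 2 * C * (n : ℝ) ^ (-η) := by
          have h3 : (n : ℝ) ^ (-η) = (n : ℝ)⁻¹ * (((n : ℝ) ^ (-δ)) ^ 2)⁻¹ * (n : ℝ) ^ θ := by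
            rw [← Real.rpow_natCast ((n : ℝ) ^ (-δ)), ← Real.rpow_mul hn'.le,
              ← Real.rpow_neg hn'.le, ← Real.rpow_neg_one, ← Real.rpow_add hn',
              ← Real.rpow_add hn']
            congr 1
            push_cast
            rw [hη]; ring
          rw [h3, mul_pow, mul_inv]
          field_simp
  have hae := ae_tendsto_zero_of_summable_integral_sq (P := P)
    (D := fun j ω => eventCount B ((j + 1) ^ K) ω / powerSum δ ((j + 1) ^ K) - 1)
    (fun j => ((measurable_eventCount hB _).div_const _).sub_const _) ?_ ?_
  · filter_upwards [hae] with ω hω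
    simp_rw [integral_eventCount hB, hE]
    have h1 := hω.add_const 1
    simp only [sub_add_cancel, zero_add] at h1
    exact tendsto_div_of_tendsto_div_pow (monotone_eventCount B ω)
      (fun n => eventCount_nonneg B n ω) (monotone_powerSum δ) (fun n hn => powerSum_pos hδ hn) (by exact_mod_cast hK0.ne')
      (tendsto_powerSum_ratio hδ K) ((tendsto_add_atTop_iff_nat
        (f := fun j => eventCount B (j ^ K) ω / powerSum δ (j ^ K)) 1).1 h1)
  · intro j
    set n := (j + 1) ^ K
    have hle : ∀ ω, eventCount B n ω ≤ n := by
      intro ω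
      have h : ∀ k ∈ Finset.Icc 1 n, (B k).indicator (fun _ => (1 : ℝ)) ω ≤ 1 := fun k _ =>
        Set.indicator_le_self' (fun _ _ => zero_le_one) ω
      simpa [eventCount] using Finset.sum_le_card_nsmul _ _ _ h
    have hp := powerSum_pos hδ (Nat.one_le_pow K (j + 1) (Nat.le_add_left 1 j))
    refine .of_bound ((((measurable_eventCount hB _).div_const _).sub_const _).pow_const
      2).aestronglyMeasurable ((n / powerSum δ n + 1) ^ 2) (Eventually.of_forall fun ω => ?_)
    rw [norm_pow]
    refine pow_le_pow_left₀ (norm_nonneg _) ((norm_sub_le _ _).trans ?_) 2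
    rw [norm_one, Real.norm_of_nonneg (div_nonneg (eventCount_nonneg _ _ _) hp.le)]
    gcongr
    exact hle ω
  · refine Summable.of_nonneg_of_le (fun j => integral_nonneg fun ω => sq_nonneg _)
      (fun j => hvar _ (Nat.one_le_pow K (j + 1) (Nat.le_add_left 1 j))) (Summable.mul_left _ ?_)
    have h1 : Summable fun j : ℕ => ((j + 1 : ℕ) : ℝ) ^ (-(K * η)) :=
      (summable_nat_add_iff 1).2 (Real.summable_nat_rpow.2 (by linarith))
    refine h1.congr fun j => ?_
    rw [Nat.cast_pow, ← Real.rpow_natCast, ← Real.rpow_mul (by positivity), mul_neg]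

end Criterion

/-! ### Visits of the walk to a drifting target -/

/-- The exponent of the target may be replaced by its positive part, as the arc is the whole circle
for a negative one. -/
theorem driftEvent_eq_preimage {Ω : Type*} (X : ℕ → Ω → UnitAddCircle) (t δ : ℝ) {n : ℕ}
    (hn : 1 ≤ n) :
    driftEvent X t δ n = X n ⁻¹' circleArc (n * t) ((n : ℝ) ^ (-max δ 0)) := by
  rcases le_total 0 δ with h | h
  · rw [max_eq_left h]
    rfl
  · rw [max_eq_right h, neg_zero, Real.rpow_zero, circleArc_eq_univ _ le_rfl,
      ← circleArc_eq_univ (n * t) (ℓ := (n : ℝ) ^ (-δ))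
        (Real.one_le_rpow (by exact_mod_cast hn) (by linarith))]
    rfl

/-- The drift translates the targets, which changes the phases of the Fourier coefficients of their
indicators but not the moduli, so that all `t` are treated alike. -/
theorem IsStationaryMarkovChain.isStronglyBorelCantelli_driftEvent {Ω : Type*} [MeasurableSpace Ω]
    {P : Measure Ω} [IsProbabilityMeasure P] {a : ℝ} {X : ℕ → Ω → UnitAddCircle}
    (hX : IsStationaryMarkovChain P (circleWalkKernel a) AddCircle.haarAddCircle X)
    (ha : WeaklyBadlyApproximable a) (t : ℝ) {δ : ℝ} (hδ : δ < 1 / 2) :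
    IsStronglyBorelCantelli P (driftEvent X t δ) := by
  have hδ' : max δ 0 < 1 / 2 := max_lt hδ (by norm_num)
  have hδ0 : 0 ≤ max δ 0 := le_max_right _ _
  have hℓ : ∀ n : ℕ, 1 ≤ n → (n : ℝ) ^ (-max δ 0) ≤ 1 := fun n hn =>
    Real.rpow_le_one_of_one_le_of_nonpos (by exact_mod_cast hn) (by linarith)
  set θ : ℝ := (1 - 2 * max δ 0) / 2 with hθ
  obtain ⟨C, hsum⟩ := exists_sum_correlationBound_le ha (θ := θ) (by linarith) (by linarith)
  refine isStronglyBorelCantelli_of_covariance_le (fun k hk => ?_) hδ0 (fun k hk => ?_)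
    (correlationBound_nonneg a) (fun i m hi => ?_) (θ := θ) (by linarith) (by linarith) hsum
  · rw [driftEvent_eq_preimage X t δ hk]
    exact hX.measurable k (measurableSet_circleArc _ _)
  · rw [driftEvent_eq_preimage X t δ hk, ← map_measureReal_apply (hX.measurable k)
      (measurableSet_circleArc _ _), hX.law k,
      haarAddCircle_real_circleArc _ (by positivity) (hℓ k hk)]
  · have him : 1 ≤ i + m := by omega
    rw [driftEvent_eq_preimage X t δ hi, driftEvent_eq_preimage X t δ him]
    exact hX.abs_measureReal_inter_sub_le i m (measurableSet_circleArc _ _)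
      (measurableSet_circleArc _ _)
      (fun k hk => norm_fourierCoeff_circleArc_le _ (by positivity) (hℓ i hi) hk)
      (fun k hk => norm_fourierCoeff_circleArc_le _ (by positivity) (hℓ _ him) hk)

theorem mainTheorem11 {Ω : Type*} [MeasurableSpace Ω] (P : Measure Ω) [IsProbabilityMeasure P]
    (a : ℝ) (ha : a ∈ Set.Icc (0 : ℝ) 1) (hirr : Irrational a)
    (hbad : WeaklyBadlyApproximable a)
    (X : ℕ → Ω → UnitAddCircle)
    (hX : IsStationaryMarkovChain P (circleWalkKernel a) AddCircle.haarAddCircle X) :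
    (∀ t ∈ Set.Ico (0 : ℝ) 1, ∀ δ : ℝ, δ < 1 / 3 →
      IsStronglyBorelCantelli P (driftEvent X t δ)) ∧
    (∀ t ∈ Set.Ico (0 : ℝ) 1, StronglyBadlyApproximable t → ∀ δ : ℝ, δ < 1 / 2 →
      IsStronglyBorelCantelli P (driftEvent X t δ)) :=
  ⟨fun t _ _ hδ => hX.isStronglyBorelCantelli_driftEvent hbad t (hδ.trans (by norm_num)),
    fun t _ _ _ hδ => hX.isStronglyBorelCantelli_driftEvent hbad t hδ⟩
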